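/- Let $N,d\ge 0$ be integers and let $P\in\mathbb C[z_0,\dots,z_N]$ be a nonzero homogeneous polynomial of degree $d$, viewed as a section of $\mathcal O(d)$ over $\mathbb P^N=\mathbb P^N(\mathbb C)$ with pointwise norm $$|P|([z])=\left(\frac{|P(z_0,\dots,z_N)|^2}{(|z_0|^2+\dots+|z_N|^2)^d}\right)^{1/2}.$$ Let $\omega_{FS}$ be the Fubini–Study form on $\mathbb P^N$, given by $\omega_{FS}=\frac{\sqrt{-1}}{2\pi}\partial\bar\partial\log(1+|w_1|^2+\dots+|w_N|^2)$ in the affine chart $w\mapsto[1:w_1:\dots:w_N]$, and put $$\|P\|_0=\exp\left(\int_{\mathbb P^N}\log|P|\,\omega_{FS}^N\right),\qquad \|P\|_p=\left(\int_{\mathbb P^N}|P|^p\,\omega_{FS}^N\right)^{1/p}\ (0<p<\infty),\qquad \|P\|_\infty=\sup_{[z]\in\mathbb P^N}|P|([z]).$$ Then $\log|P|$ and $|P|^p$ $(0<p<\infty)$ are integrable with respect to $\omega_{FS}^N$, $\|P\|_p$ $(0<p<\infty)$ and $\|P\|_\infty$ are positive and finite, and $$\log\|P\|_0\le\log\|P\|_\infty\le\log\|P\|_0+\frac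 d2\sum_{j=1}^N\frac1j .$$ Consequently the Mahler measure $\|P\|_0$ is comparable to all the $L^p$ norms: for every $p\in(0,\infty)$, $$\log\|P\|_0\le\log\|P\|_p\le\log\|P\|_0+\frac d2\sum_{j=1}^N\frac1j .$$ -/

import Mathlib

open MeasureTheory

namespace FubiniStudy

/-- Complex projective space `ℙ^N`: lines through the origin of `ℂ^(N+1)`. -/
abbrev PN (N : ℕ) : Type := Projectivization ℂ (Fin (N + 1) → ℂ)

/-- The quotient topology of `ℂ^(N+1) ∖ {0}`. -/
noncomputable instance (N : ℕ) : TopologicalSpace (PN N) :=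
  TopologicalSpace.coinduced
    (Projectivization.mk' ℂ : {v : Fin (N + 1) → ℂ // v ≠ 0} → PN N) inferInstance

noncomputable instance (N : ℕ) : MeasurableSpace (PN N) := borel (PN N)

instance (N : ℕ) : BorelSpace (PN N) := ⟨rfl⟩

/-! ### The Fubini–Study volume form -/

/-- The Wirtinger derivative `∂f/∂w_j = (∂f/∂x_j - i ∂f/∂y_j) / 2`. -/
noncomputable def dWirt {N : ℕ} (j : Fin N) (f : (Fin N → ℂ) → ℂ) (w : Fin N → ℂ) : ℂ :=
  (fderiv ℝ f w (Pi.single j 1) - Complex.I * fderiv ℝ f w (Pi.single j Complex.I)) / 2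

/-- The Wirtinger derivative `∂f/∂w̄_j = (∂f/∂x_j + i ∂f/∂y_j) / 2`. -/
noncomputable def dbarWirt {N : ℕ} (j : Fin N) (f : (Fin N → ℂ) → ℂ) (w : Fin N → ℂ) : ℂ :=
  (fderiv ℝ f w (Pi.single j 1) + Complex.I * fderiv ℝ f w (Pi.single j Complex.I)) / 2

/-- The Kähler potential `log (1 + |w|²)` of the Fubini–Study form in the affine chart
`w ↦ [1 : w_1 : … : w_N]`. -/
noncomputable def potential {N : ℕ} (w : Fin N → ℂ) : ℂ :=
  ((Real.log (1 + ∑ j, ‖w j‖ ^ 2) : ℝ) : ℂ)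

/-- The coefficients `g_{jk̄} = ∂_j ∂̄_k log (1 + |w|²)` of the Fubini–Study form
`ω_FS = (i/2π) ∑ g_{jk̄} dw_j ∧ dw̄_k` in the affine chart. -/
noncomputable def metricCoeff {N : ℕ} (w : Fin N → ℂ) : Matrix (Fin N) (Fin N) ℂ :=
  Matrix.of fun j k => dWirt j (dbarWirt k potential) w

/-- The density of `ω_FS^N` with respect to Lebesgue measure of the affine chart: since
`ω_FS^N = N! (i/2π)^N det(g) dw_1 ∧ dw̄_1 ∧ … ∧ dw_N ∧ dw̄_N` and
`i dw_j ∧ dw̄_j = 2 dx_j ∧ dy_j`, it is `(N! / π^N) det(g)`. -/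
noncomputable def density {N : ℕ} (w : Fin N → ℂ) : ℝ :=
  (N.factorial : ℝ) / Real.pi ^ N * (metricCoeff w).det.re

/-- The affine chart `w ↦ [1 : w_1 : … : w_N]`. -/
noncomputable def chart {N : ℕ} (w : Fin N → ℂ) : PN N :=
  Projectivization.mk ℂ (Fin.cons 1 w : Fin (N + 1) → ℂ)
    (fun h => one_ne_zero (α := ℂ) (by simpa using congrFun h 0))

theorem continuous_chart {N : ℕ} : Continuous (chart (N := N)) := by
  have h : Continuous (Projectivization.mk' ℂ : {v : Fin (N + 1) → ℂ // v ≠ 0} → PN N) :=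
    continuous_coinduced_rng
  have h' : Continuous (fun w : Fin N → ℂ => (⟨(Fin.cons 1 w : Fin (N + 1) → ℂ),
      fun h => one_ne_zero (α := ℂ) (by simpa using congrFun h 0)⟩ :
        {v : Fin (N + 1) → ℂ // v ≠ 0})) := by
    refine Continuous.subtype_mk (continuous_pi fun i => ?_) _
    refine Fin.cases ?_ (fun j => ?_) i
    · simpa using continuous_const
    · simpa using continuous_apply j
  exact h.comp h'

theorem measurable_chart {N : ℕ} : Measurable (chart (N := N)) :=
  continuous_chart.measurable

/-- The measure on `ℙ^N` given by the volume form `ω_FS^N`. The complement of the affine chart is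
a hyperplane, which a volume form does not charge. -/
noncomputable def measure (N : ℕ) : Measure (PN N) :=
  Measure.map chart
    ((volume : Measure (Fin N → ℂ)).withDensity fun w => ENNReal.ofReal (density w))

/-! ### The norms of a homogeneous polynomial -/

/-- The pointwise norm `|P|_{h_FS^d}([z])` of a homogeneous polynomial of degree `d`, seen as a
section of `𝒪(d)`: its square is `|P(z)|² / (|z_0|² + … + |z_N|²)^d`. -/
noncomputable def pointNorm {N : ℕ} (d : ℕ) (P : MvPolynomial (Fin (N + 1)) ℂ) (x : PN N) : ℝ :=
  Real.sqrt (‖MvPolynomial.eval x.rep P‖ ^ 2 / (∑ i, ‖x.rep i‖ ^ 2) ^ d)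

/-- The pointwise norm may be computed with any homogeneous coordinates. -/
theorem pointNorm_mk {N d : ℕ} {P : MvPolynomial (Fin (N + 1)) ℂ} (hP : P.IsHomogeneous d)
    (z : Fin (N + 1) → ℂ) (hz : z ≠ 0) :
    pointNorm d P (Projectivization.mk ℂ z hz) =
      Real.sqrt (‖MvPolynomial.eval z P‖ ^ 2 / (∑ i, ‖z i‖ ^ 2) ^ d) := by
  obtain ⟨a, ha⟩ := Projectivization.exists_smul_eq_mk_rep ℂ z hz
  have ha0 : ‖(a : ℂ)‖ ≠ 0 := by simp
  have h1 : MvPolynomial.eval ((a : ℂ) • z) P = (a : ℂ) ^ d * MvPolynomial.eval z P := by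
    rw [MvPolynomial.eval_eq', MvPolynomial.eval_eq', Finset.mul_sum]
    refine Finset.sum_congr rfl fun s hs => ?_
    have hd : ∑ i, s i = d := by
      rw [hP.degree_eq_sum_deg_support hs, ← Finsupp.degree_apply, Finsupp.degree_eq_sum]
    simp only [Pi.smul_apply, smul_eq_mul, mul_pow, Finset.prod_mul_distrib,
      Finset.prod_pow_eq_pow_sum, hd]
    ring
  have h2 : ∑ i, ‖((a : ℂ) • z) i‖ ^ 2 = ‖(a : ℂ)‖ ^ 2 * ∑ i, ‖z i‖ ^ 2 := by
    simp [mul_pow, Finset.mul_sum]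
  unfold pointNorm
  rw [← ha, Units.smul_def, h1, h2, norm_mul, norm_pow, mul_pow, mul_pow, ← pow_mul, ← pow_mul,
    mul_comm d 2, mul_div_mul_left _ _ (pow_ne_zero _ ha0)]

/-- The Mahler measure `‖P‖₀ = exp ∫ log |P|_{h_FS^d} ω_FS^N`. -/
noncomputable def mahlerNorm {N : ℕ} (d : ℕ) (P : MvPolynomial (Fin (N + 1)) ℂ) : ℝ :=
  Real.exp (∫ x, Real.log (pointNorm d P x) ∂(measure N))

/-- `‖P‖_p = (∫ |P|_{h_FS^d}^p ω_FS^N)^{1/p}`, for `0 < p < ∞`. -/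
noncomputable def lpNorm {N : ℕ} (p : ℝ) (d : ℕ) (P : MvPolynomial (Fin (N + 1)) ℂ) : ℝ :=
  (∫ x, pointNorm d P x ^ p ∂(measure N)) ^ (1 / p)

/-- `‖P‖_∞ = sup |P|_{h_FS^d}`. -/
noncomputable def supNorm {N : ℕ} (d : ℕ) (P : MvPolynomial (Fin (N + 1)) ℂ) : ℝ :=
  ⨆ x : PN N, pointNorm d P x

end FubiniStudy

namespace FubiniStudy

/-! ### The Fubini–Study density -/

/-! Let `a` be a unit vector with `P(a) ≠ 0`. Unitary invariance of `ω_FS^N` allows an affine chart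
centred at `a`, in which `w` goes to `a + b` with `b ⊥ a` depending linearly on `w`. On the circle
`a + e^{iθ} b` the denominator `S = 1 + |w|²` is constant, so `log|P|` differs from
`log|q(e^{iθ})|`, with `q(t) = P(a + t b)`, by the constant `(d/2) log S`. Jensen's inequality
bounds the circle mean of `log|q|` below by `log|q(0)| = log|P(a)|`. The mean of `log (1 + |w|²)` is
the harmonic number `H_N`, hence `log|P(a)| ≤ ∫ log|P| + (d/2) H_N`; the supremum over `a` gives the
main bound. The ingredients are `lintegral_density_mul_log` (harmonic number),
`lintegral_density_comp_unitary` (invariance) and `log_norm_eval_zero_le_logMahlerMeasure` (Jensen),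
combined in `lintegral_sub_log_vecNorm_le`. Integrals are taken in `ENNReal` of `B - log|P|` with
`B` an upper bound of `log|P|`, so that integrability of `log|P|` comes out of the same estimate.
The `L^p` norms are squeezed between the Mahler measure (convexity of `exp`) and the sup norm (total
mass `1`). -/

theorem hasFDerivAt_one_add_sum_norm_sq {N : ℕ} (w : Fin N → ℂ) :
    HasFDerivAt (fun w : Fin N → ℂ => 1 + ∑ j, ‖w j‖ ^ 2)
      (∑ j, (2 : ℝ) • (innerSL ℝ (w j)).comp (ContinuousLinearMap.proj (R := ℝ) j)) w := by
  refine HasFDerivAt.const_add _ (HasFDerivAt.fun_sum fun j _ => ?_)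
  simpa [ofNat_smul_eq_nsmul ℝ 2] using
    (ContinuousLinearMap.proj (R := ℝ) (φ := fun _ : Fin N => ℂ) j).hasFDerivAt.norm_sq (x := w)

theorem sum_inner_single {N : ℕ} (w : Fin N → ℂ) (j : Fin N) (c : ℂ) :
    (∑ i, (2 : ℝ) • (innerSL ℝ (w i)).comp (ContinuousLinearMap.proj (R := ℝ) i) :
      (Fin N → ℂ) →L[ℝ] ℝ) (Pi.single j c) = 2 * (c * starRingEnd ℂ (w j)).re := by
  rw [sum_apply, Finset.sum_eq_single j]
  · simp [Complex.inner]
  · intro i _ hi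
    simp [Pi.single_eq_of_ne hi]
  · simp

theorem one_add_sum_norm_sq_pos {N : ℕ} (w : Fin N → ℂ) : 0 < 1 + ∑ j, ‖w j‖ ^ 2 := by
  positivity

theorem dbarWirt_potential {N : ℕ} (k : Fin N) :
    dbarWirt k (potential (N := N)) =
      fun w => w k * (((1 + ∑ j, ‖w j‖ ^ 2)⁻¹ : ℝ) : ℂ) := by
  funext w
  have h := Complex.ofRealCLM.hasFDerivAt.comp w
    ((hasFDerivAt_one_add_sum_norm_sq w).log (one_add_sum_norm_sq_pos w).ne')
  have h' : fderiv ℝ (potential (N := N)) w = _ := h.fderiv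
  unfold dbarWirt
  simp only [h', ContinuousLinearMap.comp_apply, smul_apply, sum_inner_single,
    Complex.ofRealCLM_apply]
  apply Complex.ext <;> simp [-Complex.ofReal_pow] <;> ring

theorem metricCoeff_apply {N : ℕ} (w : Fin N → ℂ) (j k : Fin N) :
    metricCoeff w j k = (((1 + ∑ j, ‖w j‖ ^ 2)⁻¹ : ℝ) : ℂ) * ((if j = k then 1 else 0) -
      (((1 + ∑ j, ‖w j‖ ^ 2)⁻¹ : ℝ) : ℂ) * starRingEnd ℂ (w j) * w k) := by
  have h1 := Complex.ofRealCLM.hasFDerivAt.comp w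
    ((hasDerivAt_inv (one_add_sum_norm_sq_pos w).ne').comp_hasFDerivAt w
      (hasFDerivAt_one_add_sum_norm_sq w))
  have h := ((ContinuousLinearMap.proj (R := ℝ) (φ := fun _ : Fin N => ℂ) k).hasFDerivAt
    (x := w)).mul h1
  have h' : fderiv ℝ (fun w : Fin N → ℂ => w k * (((1 + ∑ j, ‖w j‖ ^ 2)⁻¹ : ℝ) : ℂ)) w = _ :=
    h.fderiv
  simp only [metricCoeff, Matrix.of_apply, dbarWirt_potential]
  unfold dWirt
  simp only [h', ContinuousLinearMap.comp_apply, smul_apply,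
    add_apply, sum_inner_single, Complex.ofRealCLM_apply,
    ContinuousLinearMap.proj_apply, Function.comp_apply]
  -- Differentiating the inverse produces `(S ^ 2)⁻¹`; written as `(S⁻¹) ^ 2`, both sides are
  -- polynomial in `T = S⁻¹`.
  rw [← inv_pow]
  generalize (1 + ∑ j, ‖w j‖ ^ 2)⁻¹ = T
  rcases eq_or_ne j k with rfl | hjk
  · apply Complex.ext <;> simp [-Complex.ofReal_pow] <;> ring
  · apply Complex.ext <;> simp [hjk, -Complex.ofReal_pow] <;> ring

/-- The metric is `S⁻¹` times a rank-one perturbation of the identity, so the matrix determinant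
lemma gives `S^{-N} (1 - |w|²/S) = S^{-(N+1)}`. -/
theorem density_eq {N : ℕ} (w : Fin N → ℂ) :
    density w = (N.factorial : ℝ) / Real.pi ^ N * ((1 + ∑ j, ‖w j‖ ^ 2) ^ (N + 1))⁻¹ := by
  have hpos := one_add_sum_norm_sq_pos w
  set S : ℝ := 1 + ∑ j, ‖w j‖ ^ 2 with hS
  have hm : metricCoeff w = ((S⁻¹ : ℝ) : ℂ) • (1 + Matrix.replicateCol Unit
      (fun j => -((S⁻¹ : ℝ) : ℂ) * starRingEnd ℂ (w j)) * Matrix.replicateRow Unit w) := by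
    ext j k
    rw [metricCoeff_apply]
    simp [Matrix.mul_apply, Matrix.one_apply, hS]
    left
    ring
  have hdot : w ⬝ᵥ (fun j => -((S⁻¹ : ℝ) : ℂ) * starRingEnd ℂ (w j)) =
      ((-(S⁻¹ * (S - 1)) : ℝ) : ℂ) := by
    have : S - 1 = ∑ j, ‖w j‖ ^ 2 := by rw [hS]; ring
    rw [this]
    simp only [dotProduct]
    push_cast
    rw [← neg_mul, Finset.mul_sum]
    refine Finset.sum_congr rfl fun j _ => ?_
    rw [← Complex.mul_conj']
    ring
  have hdet : (metricCoeff w).det = (((S ^ (N + 1))⁻¹ : ℝ) : ℂ) := by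
    rw [hm, Matrix.det_smul, Matrix.det_one_add_replicateCol_mul_replicateRow, hdot]
    rw [Fintype.card_fin, ← Complex.ofReal_pow, ← Complex.ofReal_one, ← Complex.ofReal_add,
      ← Complex.ofReal_mul]
    congr 1
    have h1 : 1 + -(S⁻¹ * (S - 1)) = S⁻¹ := by field_simp; ring
    rw [h1, ← pow_succ, inv_pow]
  rw [density, hdet, Complex.ofReal_re]

theorem density_nonneg {N : ℕ} (w : Fin N → ℂ) : 0 ≤ density w := by
  rw [density_eq]; positivity

/-! ### Radial integrals against the Fubini–Study density -/

theorem measurable_finCons {n : ℕ} :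
    Measurable (fun p : ℂ × (Fin n → ℂ) => (Fin.cons p.1 p.2 : Fin (n + 1) → ℂ)) := by
  refine measurable_pi_lambda _ fun i => ?_
  refine Fin.cases ?_ (fun j => ?_) i
  · simpa using measurable_fst
  · simpa [Function.comp_def] using (measurable_pi_apply j).comp (measurable_snd (α := ℂ))

theorem lintegral_fin_succ_prod {n : ℕ} {f : (Fin (n + 1) → ℂ) → ENNReal} :
    ∫⁻ z, f z = ∫⁻ p : ℂ × (Fin n → ℂ), f (Fin.cons p.1 p.2) := by
  have h := (volume_preserving_piFinSuccAbove (fun _ : Fin (n + 1) => ℂ) 0).symm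
  rw [← h.map_eq, lintegral_map_equiv]
  refine lintegral_congr fun p => ?_
  congr 1
  simp [MeasurableEquiv.piFinSuccAbove, Fin.insertNthEquiv]

theorem lintegral_fin_succ {n : ℕ} {f : (Fin (n + 1) → ℂ) → ENNReal} (hf : Measurable f) :
    ∫⁻ z, f z = ∫⁻ x : ℂ, ∫⁻ w : Fin n → ℂ, f (Fin.cons x w) := by
  rw [lintegral_fin_succ_prod, Measure.volume_eq_prod,
    lintegral_prod (fun p : ℂ × (Fin n → ℂ) => f (Fin.cons p.1 p.2))
      (hf.comp measurable_finCons).aemeasurable]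

theorem lintegral_fin_succ_symm {n : ℕ} {f : (Fin (n + 1) → ℂ) → ENNReal} (hf : Measurable f) :
    ∫⁻ z, f z = ∫⁻ w : Fin n → ℂ, ∫⁻ x : ℂ, f (Fin.cons x w) := by
  rw [lintegral_fin_succ_prod, Measure.volume_eq_prod,
    lintegral_prod_symm (fun p : ℂ × (Fin n → ℂ) => f (Fin.cons p.1 p.2))
      (hf.comp measurable_finCons).aemeasurable]

theorem lintegral_complex_radial {g : ℝ → ENNReal} (hg : Measurable g) :
    ∫⁻ x : ℂ, g ‖x‖ =
      ENNReal.ofReal (2 * Real.pi) * ∫⁻ r in Set.Ioi (0 : ℝ), ENNReal.ofReal r * g r := by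
  rw [← Complex.lintegral_comp_polarCoord_symm, polarCoord_target, Measure.volume_eq_prod,
    ← Measure.prod_restrict]
  have h1 : ∀ᵐ p : ℝ × ℝ ∂((volume.restrict (Set.Ioi (0 : ℝ))).prod
      (volume.restrict (Set.Ioo (-Real.pi) Real.pi))),
      ENNReal.ofReal p.1 • g ‖Complex.polarCoord.symm p‖ = (ENNReal.ofReal p.1 * g p.1) * 1 := by
    rw [Measure.prod_restrict]
    filter_upwards [ae_restrict_mem (measurableSet_Ioi.prod measurableSet_Ioo)] with p hp
    rw [Complex.norm_polarCoord_symm, abs_of_pos hp.1, smul_eq_mul, mul_one]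
  rw [lintegral_congr_ae h1, lintegral_prod_mul (f := fun r => ENNReal.ofReal r * g r)
    (g := fun _ => 1) (by fun_prop) (by fun_prop)]
  rw [mul_comm]
  congr 1
  rw [lintegral_const, Measure.restrict_apply_univ, Real.volume_Ioo, one_mul]
  ring_nf

theorem tendsto_inv_pow_mul_log (n : ℕ) (a c : ℝ) :
    Filter.Tendsto (fun u : ℝ => (u ^ (n + 1))⁻¹ * (a * Real.log u + c)) Filter.atTop (nhds 0) := by
  have h1 : Filter.Tendsto (fun u : ℝ => Real.log u / u) Filter.atTop (nhds 0) := by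
    simpa using Real.tendsto_pow_log_div_mul_add_atTop 1 0 1 one_ne_zero
  have h2 : Filter.Tendsto (fun u : ℝ => (u⁻¹) ^ n * (a * (Real.log u / u) + c * u⁻¹))
      Filter.atTop (nhds (0 ^ n * (a * 0 + c * 0))) :=
    (tendsto_inv_atTop_zero.pow n).mul ((h1.const_mul a).add (tendsto_inv_atTop_zero.const_mul c))
  simp only [mul_zero, add_zero] at h2
  refine h2.congr fun u => ?_
  rw [pow_succ, mul_inv, inv_pow]
  ring

/-- In polar coordinates the integrand has an elementary antiderivative in `A + r²`. The condition
`1 ≤ A` keeps the logarithm, hence the integrand, nonnegative. -/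
theorem lintegral_inv_pow_mul_log (n : ℕ) {A a b : ℝ} (hA : 1 ≤ A) (ha : 0 ≤ a) (hb : 0 ≤ b) :
    ∫⁻ x : ℂ, ENNReal.ofReal (((A + ‖x‖ ^ 2) ^ (n + 2))⁻¹ * (a * Real.log (A + ‖x‖ ^ 2) + b)) =
      ENNReal.ofReal (Real.pi / (n + 1) * ((A ^ (n + 1))⁻¹ *
        (a * Real.log A + (a / (n + 1) + b)))) := by
  -- Differentiating `u^{-(n+1)} (a log u + c)` yields `c - a/(n+1)` in place of `c`; this choice
  -- turns it into `b`.
  set c : ℝ := a / (n + 1) + b with hc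
  have hpos : ∀ r : ℝ, 1 ≤ A + r ^ 2 := fun r => by nlinarith [sq_nonneg r]
  rw [lintegral_complex_radial (g := fun r => ENNReal.ofReal (((A + r ^ 2) ^ (n + 2))⁻¹ *
    (a * Real.log (A + r ^ 2) + b))) (by fun_prop)]
  have hderiv : ∀ r ∈ Set.Ici (0 : ℝ), HasDerivAt
      (fun r : ℝ => -(2 * (n + 1) : ℝ)⁻¹ * (((A + r ^ 2) ^ (n + 1))⁻¹ *
        (a * Real.log (A + r ^ 2) + c)))
      (r * (((A + r ^ 2) ^ (n + 2))⁻¹ * (a * Real.log (A + r ^ 2) + b))) r := by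
    intro r _
    have hu : HasDerivAt (fun r : ℝ => A + r ^ 2) (2 * r) r := by
      simpa using (hasDerivAt_pow 2 r).const_add A
    have hu0 : A + r ^ 2 ≠ 0 := by linarith [hpos r]
    refine ((((hu.pow (n + 1)).inv (pow_ne_zero _ hu0)).mul
      (((hu.log hu0).const_mul a).add_const c)).const_mul (-(2 * (n + 1) : ℝ)⁻¹)).congr_deriv ?_
    rw [hc]
    have hn : (n : ℝ) + 1 ≠ 0 := by positivity
    simp only [Pi.inv_apply, Pi.pow_apply]
    push_cast
    field_simp
    ring
  have hnn : ∀ r ∈ Set.Ioi (0 : ℝ),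
      0 ≤ r * (((A + r ^ 2) ^ (n + 2))⁻¹ * (a * Real.log (A + r ^ 2) + b)) := by
    intro r hr
    have := Real.log_nonneg (hpos r)
    have := (zero_lt_one.trans_le (hpos r)).le
    have : 0 < r := hr
    positivity
  have hlim : Filter.Tendsto (fun r : ℝ => -(2 * (n + 1) : ℝ)⁻¹ * (((A + r ^ 2) ^ (n + 1))⁻¹ *
        (a * Real.log (A + r ^ 2) + c))) Filter.atTop (nhds 0) := by
    have h := ((tendsto_inv_pow_mul_log n a c).comp (Filter.tendsto_atTop_add_const_left _ A
      (Filter.tendsto_pow_atTop (α := ℝ) two_ne_zero))).const_mul (-(2 * (n + 1) : ℝ)⁻¹)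
    simpa using h
  have hint := integrableOn_Ioi_deriv_of_nonneg' hderiv hnn hlim
  have hval := integral_Ioi_of_hasDerivAt_of_nonneg' hderiv hnn hlim
  have h2 : ∫⁻ r in Set.Ioi (0 : ℝ), ENNReal.ofReal r * ENNReal.ofReal
        (((A + r ^ 2) ^ (n + 2))⁻¹ * (a * Real.log (A + r ^ 2) + b)) =
      ENNReal.ofReal (∫ r in Set.Ioi (0 : ℝ),
        r * (((A + r ^ 2) ^ (n + 2))⁻¹ * (a * Real.log (A + r ^ 2) + b))) := by
    rw [ofReal_integral_eq_lintegral_ofReal hint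
      ((ae_restrict_mem measurableSet_Ioi).mono hnn)]
    exact setLIntegral_congr_fun measurableSet_Ioi fun r hr =>
      (ENNReal.ofReal_mul (le_of_lt hr)).symm
  rw [h2, hval, ← ENNReal.ofReal_mul (by positivity)]
  congr 1
  simp only [ne_eq, OfNat.ofNat_ne_zero, not_false_eq_true, zero_pow, add_zero]
  field_simp
  ring

/-- The harmonic number is the mean of `log (1 + |w|²)` for `ω_FS^N`, and `ω_FS^N` has total
mass `1`. -/
theorem lintegral_density_mul_log (N : ℕ) {a b : ℝ} (ha : 0 ≤ a) (hb : 0 ≤ b) :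
    ∫⁻ w : Fin N → ℂ, ENNReal.ofReal (density w) *
        ENNReal.ofReal (a * Real.log (1 + ∑ j, ‖w j‖ ^ 2) + b) =
      ENNReal.ofReal (a * ∑ j ∈ Finset.Icc 1 N, 1 / (j : ℝ) + b) := by
  -- Integrating out one coordinate turns the density in dimension `n + 1` into that in dimension
  -- `n` and replaces `b` by `b + a/(n+1)`, which supplies the next harmonic term.
  induction N generalizing b with
  | zero =>
    rw [lintegral_unique]
    simp [density_eq, volume_pi]
  | succ n ih =>
    have hmeas : Measurable fun w : Fin (n + 1) → ℂ => ENNReal.ofReal (density w) *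
        ENNReal.ofReal (a * Real.log (1 + ∑ j, ‖w j‖ ^ 2) + b) := by
      simp only [density_eq]
      fun_prop
    rw [lintegral_fin_succ_symm hmeas, Finset.sum_Icc_succ_top (by omega)]
    have hb' : 0 ≤ a / (n + 1) + b := by positivity
    have h1 : a * (∑ j ∈ Finset.Icc 1 n, 1 / (j : ℝ) + 1 / ((n + 1 : ℕ) : ℝ)) + b =
        a * ∑ j ∈ Finset.Icc 1 n, 1 / (j : ℝ) + (a / (n + 1) + b) := by
      push_cast; ring
    rw [h1, ← ih hb']
    refine lintegral_congr fun w => ?_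
    have hA : 1 ≤ 1 + ∑ j, ‖w j‖ ^ 2 := by
      have : 0 ≤ ∑ j, ‖w j‖ ^ 2 := by positivity
      linarith
    have h2 : ∀ x : ℂ, ENNReal.ofReal (density (Fin.cons x w : Fin (n + 1) → ℂ)) *
        ENNReal.ofReal (a * Real.log (1 + ∑ j, ‖(Fin.cons x w : Fin (n + 1) → ℂ) j‖ ^ 2) + b) =
        ENNReal.ofReal (((n + 1).factorial : ℝ) / Real.pi ^ (n + 1)) *
          ENNReal.ofReal ((((1 + ∑ j, ‖w j‖ ^ 2) + ‖x‖ ^ 2) ^ (n + 2))⁻¹ *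
            (a * Real.log ((1 + ∑ j, ‖w j‖ ^ 2) + ‖x‖ ^ 2) + b)) := by
      intro x
      have h3 : 1 + ∑ j, ‖(Fin.cons x w : Fin (n + 1) → ℂ) j‖ ^ 2 =
          (1 + ∑ j, ‖w j‖ ^ 2) + ‖x‖ ^ 2 := by
        rw [Fin.sum_univ_succ]
        simp only [Fin.cons_zero, Fin.cons_succ]
        ring
      rw [← ENNReal.ofReal_mul (density_nonneg _), ← ENNReal.ofReal_mul (by positivity), density_eq, h3,
        mul_assoc]
    simp only [h2]
    rw [lintegral_const_mul _ (by fun_prop), lintegral_inv_pow_mul_log n hA ha hb,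
      ← ENNReal.ofReal_mul (by positivity), ← ENNReal.ofReal_mul (density_nonneg _), density_eq]
    congr 1
    rw [Nat.factorial_succ, pow_succ]
    push_cast
    field_simp

/-! ### Unitary invariance, by comparison with the Gaussian measure of `ℂ^(N+1)` -/

theorem measurable_density {N : ℕ} : Measurable (density (N := N)) := by
  have : density (N := N) = fun w =>
      (N.factorial : ℝ) / Real.pi ^ N * ((1 + ∑ j, ‖w j‖ ^ 2) ^ (N + 1))⁻¹ := funext density_eq
  rw [this]
  fun_prop

theorem lintegral_comp_linearMap {n : ℕ} {L : (Fin n → ℂ) →ₗ[ℝ] (Fin n → ℂ)}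
    (hL : LinearMap.det L ≠ 0) {f : (Fin n → ℂ) → ENNReal} (hf : Measurable f) :
    ∫⁻ w, f (L w) = ENNReal.ofReal |(LinearMap.det L)⁻¹| * ∫⁻ w, f w := by
  have hLm : Measurable L := L.continuous_of_finiteDimensional.measurable
  rw [← lintegral_map hf hLm, Measure.map_linearMap_addHaar_eq_smul_addHaar _ hL,
    lintegral_smul_measure, smul_eq_mul]

/-- The real determinant of scaling by `c` is the norm from `ℂ` to `ℝ` of its complex determinant `c
^ n`. -/
theorem lintegral_eq_mul_lintegral_comp_smul {n : ℕ} {c : ℂ} (hc : c ≠ 0)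
    {f : (Fin n → ℂ) → ENNReal} (hf : Measurable f) :
    ∫⁻ w, f w = ENNReal.ofReal (‖c‖ ^ (2 * n)) * ∫⁻ w, f (c • w) := by
  set L : (Fin n → ℂ) →ₗ[ℝ] (Fin n → ℂ) :=
    (c • (LinearMap.id : (Fin n → ℂ) →ₗ[ℂ] (Fin n → ℂ))).restrictScalars ℝ with hLdef
  have hdet : LinearMap.det L = ‖c‖ ^ (2 * n) := by
    rw [hLdef, LinearMap.det_restrictScalars, LinearMap.det_smul, LinearMap.det_id, mul_one,
      Module.finrank_fin_fun, Algebra.norm_complex_apply, map_pow, Complex.normSq_eq_norm_sq,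
      pow_mul]
  have hpos : 0 < ‖c‖ ^ (2 * n) := by positivity
  have h := lintegral_comp_linearMap (L := L) (by rw [hdet]; exact hpos.ne') hf
  rw [hdet, abs_of_pos (inv_pos.2 hpos)] at h
  change ∫⁻ w, f (c • w) = _ at h
  rw [h, ← mul_assoc, ← ENNReal.ofReal_mul hpos.le, mul_inv_cancel₀ hpos.ne', ENNReal.ofReal_one,
    one_mul]

theorem lintegral_norm_pow_mul_exp (n : ℕ) {A : ℝ} (hA : 0 < A) :
    ∫⁻ x : ℂ, ENNReal.ofReal (‖x‖ ^ (2 * n) * Real.exp (-(A * ‖x‖ ^ 2))) =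
      ENNReal.ofReal (Real.pi * n.factorial * (A ^ (n + 1))⁻¹) := by
  have h := Complex.integral_rpow_mul_exp_neg_mul_rpow (p := 2) (q := ((2 * n : ℕ) : ℝ))
    (by norm_num) (by have : (0 : ℝ) ≤ ((2 * n : ℕ) : ℝ) := by positivity
                      linarith) hA
  have h1 : (((2 * n : ℕ) : ℝ) + 2) / 2 = ((n + 1 : ℕ) : ℝ) := by push_cast; ring
  rw [neg_div, h1, Real.rpow_neg hA.le, Real.rpow_natCast, Nat.cast_succ,
    Real.Gamma_nat_eq_factorial] at h
  simp only [Real.rpow_natCast, neg_mul, Real.rpow_ofNat] at h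
  have hint : Integrable fun x : ℂ => ‖x‖ ^ (2 * n) * Real.exp (-(A * ‖x‖ ^ 2)) := by
    -- The Bochner integral of a non-integrable function is `0` by convention, whereas the known
    -- value is positive.
    by_contra hcon
    rw [integral_undef hcon] at h
    have : 0 < 2 * Real.pi / 2 * (A ^ (n + 1))⁻¹ * n.factorial := by positivity
    linarith
  rw [← ofReal_integral_eq_lintegral_ofReal hint
    (Filter.Eventually.of_forall fun x => by positivity), h]
  congr 1
  ring

/-- For functions that are constant on the lines through the origin, the mean for `ω_FS^N` is the
mean for the Gaussian measure of `ℂ^(N+1)`. -/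
theorem lintegral_mul_exp_eq {N : ℕ} {F : (Fin (N + 1) → ℂ) → ENNReal} (hF : Measurable F)
    (hFc : ∀ (c : ℂ) (z : Fin (N + 1) → ℂ), c ≠ 0 → F (c • z) = F z) :
    ∫⁻ z, F z * ENNReal.ofReal (Real.exp (-∑ i, ‖z i‖ ^ 2)) =
      ENNReal.ofReal (Real.pi ^ (N + 1)) *
        ∫⁻ w : Fin N → ℂ, F (Fin.cons 1 w) * ENNReal.ofReal (density w) := by
  have hcons : Measurable fun w : Fin N → ℂ => (Fin.cons 1 w : Fin (N + 1) → ℂ) :=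
    measurable_finCons.comp measurable_prodMk_left
  rw [lintegral_fin_succ (by fun_prop)]
  -- On the slice `x ≠ 0`, substitute `x • w` for `w`: the point becomes `x • (1, w)`, `F` no longer
  -- sees `x`, and the Jacobian is `‖x‖ ^ (2 * N)`. The remaining integral over `x` then produces
  -- `π^{N+1}` times the density.
  have h1 : ∀ᵐ x : ℂ, ∫⁻ w : Fin N → ℂ, F (Fin.cons x w) *
        ENNReal.ofReal (Real.exp (-∑ i, ‖(Fin.cons x w : Fin (N + 1) → ℂ) i‖ ^ 2)) =
      ∫⁻ w : Fin N → ℂ, F (Fin.cons 1 w) * ENNReal.ofReal (‖x‖ ^ (2 * N) *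
        Real.exp (-((1 + ∑ j, ‖w j‖ ^ 2) * ‖x‖ ^ 2))) := by
    filter_upwards [compl_mem_ae_iff.2 (measure_singleton (0 : ℂ))] with x hx
    have hx0 : x ≠ 0 := hx
    have hm : Measurable fun w : Fin N → ℂ => F (Fin.cons x w) *
        ENNReal.ofReal (Real.exp (-∑ i, ‖(Fin.cons x w : Fin (N + 1) → ℂ) i‖ ^ 2)) := by
      have hcx : Measurable fun w : Fin N → ℂ => (Fin.cons x w : Fin (N + 1) → ℂ) :=
        measurable_finCons.comp measurable_prodMk_left
      fun_prop
    rw [lintegral_eq_mul_lintegral_comp_smul hx0 hm,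
      ← lintegral_const_mul' _ _ ENNReal.ofReal_ne_top]
    refine lintegral_congr fun w => ?_
    have h2 : (Fin.cons x (x • w) : Fin (N + 1) → ℂ) = x • Fin.cons 1 w := by
      ext i
      refine Fin.cases ?_ (fun j => ?_) i <;> simp
    have h3 : ∑ i, ‖(x • (Fin.cons 1 w : Fin (N + 1) → ℂ)) i‖ ^ 2 =
        (1 + ∑ j, ‖w j‖ ^ 2) * ‖x‖ ^ 2 := by
      rw [Fin.sum_univ_succ]
      simp [mul_pow, ← Finset.mul_sum]
      ring
    rw [h2, hFc x _ hx0, h3, ENNReal.ofReal_mul (by positivity)]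
    ring
  rw [lintegral_congr_ae h1, lintegral_lintegral_swap
    (by have h := hF.comp
          (hcons.comp (measurable_snd : Measurable (Prod.snd : ℂ × (Fin N → ℂ) → _)))
        exact (h.mul (by fun_prop)).aemeasurable),
    ← lintegral_const_mul' _ _ ENNReal.ofReal_ne_top]
  refine lintegral_congr fun w => ?_
  rw [lintegral_const_mul _ (by fun_prop), lintegral_norm_pow_mul_exp N (by positivity),
    mul_left_comm, ← ENNReal.ofReal_mul (by positivity), density_eq]
  congr 2
  field_simp
  ring

theorem lintegral_density (N : ℕ) :
    ∫⁻ w : Fin N → ℂ, ENNReal.ofReal (density w) = 1 := by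
  simpa using lintegral_density_mul_log N le_rfl zero_le_one

theorem lintegral_exp_neg_sum_norm_sq (N : ℕ) :
    ∫⁻ z : Fin (N + 1) → ℂ, ENNReal.ofReal (Real.exp (-∑ i, ‖z i‖ ^ 2)) =
      ENNReal.ofReal (Real.pi ^ (N + 1)) := by
  simpa [lintegral_density] using
    lintegral_mul_exp_eq (N := N) (F := fun _ => 1) measurable_const fun _ _ _ => rfl

/-- A linear bijection scales Lebesgue measure by a constant. Testing on the Gaussian, which `U`
fixes and whose integral is finite and nonzero, shows that the constant is `1`. -/
theorem lintegral_comp_unitary {N : ℕ} {U : (Fin (N + 1) → ℂ) →ₗ[ℂ] (Fin (N + 1) → ℂ)}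
    (hU : ∀ z, ∑ i, ‖U z i‖ ^ 2 = ∑ i, ‖z i‖ ^ 2) {f : (Fin (N + 1) → ℂ) → ENNReal}
    (hf : Measurable f) : ∫⁻ z, f (U z) = ∫⁻ z, f z := by
  have hinj : Function.Injective U := by
    rw [injective_iff_map_eq_zero]
    intro z hz
    have h := hU z
    rw [hz] at h
    have h0 : ∑ i, ‖z i‖ ^ 2 = 0 := by rw [← h]; simp
    rw [Finset.sum_eq_zero_iff_of_nonneg fun i _ => by positivity] at h0
    ext i
    simpa using h0 i (Finset.mem_univ i)
  have hdet : LinearMap.det (U.restrictScalars ℝ) ≠ 0 := by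
    have hker : LinearMap.ker (U.restrictScalars ℝ) = ⊥ := LinearMap.ker_eq_bot.2 hinj
    exact fun h => (LinearMap.bot_lt_ker_of_det_eq_zero h).ne' hker
  have key : ∀ {g : (Fin (N + 1) → ℂ) → ENNReal}, Measurable g → _ :=
    fun hg => lintegral_comp_linearMap hdet hg
  have h1 := key (g := fun z => ENNReal.ofReal (Real.exp (-∑ i, ‖z i‖ ^ 2))) (by fun_prop)
  simp only [LinearMap.restrictScalars_apply, hU, lintegral_exp_neg_sum_norm_sq] at h1
  have h2 : ENNReal.ofReal |(LinearMap.det (U.restrictScalars ℝ))⁻¹| = 1 := by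
    have hne : ENNReal.ofReal (Real.pi ^ (N + 1)) ≠ 0 := by
      rw [ENNReal.ofReal_ne_zero_iff]; positivity
    exact ((ENNReal.mul_eq_right hne ENNReal.ofReal_ne_top).1 h1.symm)
  have h3 := key hf
  rwa [h2, one_mul] at h3

/-- Both sides are Gaussian means on `ℂ^(N+1)` up to the same factor, and the Gaussian measure is
invariant under `U`. -/
theorem lintegral_density_comp_unitary {N : ℕ} {U : (Fin (N + 1) → ℂ) →ₗ[ℂ] (Fin (N + 1) → ℂ)}
    (hU : ∀ z, ∑ i, ‖U z i‖ ^ 2 = ∑ i, ‖z i‖ ^ 2) {F : (Fin (N + 1) → ℂ) → ENNReal}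
    (hF : Measurable F) (hFc : ∀ (c : ℂ) (z : Fin (N + 1) → ℂ), c ≠ 0 → F (c • z) = F z) :
    ∫⁻ w : Fin N → ℂ, F (U (Fin.cons 1 w)) * ENNReal.ofReal (density w) =
      ∫⁻ w : Fin N → ℂ, F (Fin.cons 1 w) * ENNReal.ofReal (density w) := by
  have hUm : Measurable U := U.continuous_of_finiteDimensional.measurable
  have h1 := lintegral_mul_exp_eq (F := fun z => F (U z)) (hF.comp hUm)
    fun c z hc => by rw [map_smul, hFc c _ hc]
  have h2 := lintegral_comp_unitary hU
    (f := fun z => F z * ENNReal.ofReal (Real.exp (-∑ i, ‖z i‖ ^ 2))) (by fun_prop)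
  simp only [hU] at h2
  rw [h1, lintegral_mul_exp_eq hF hFc] at h2
  have hne : ENNReal.ofReal (Real.pi ^ (N + 1)) ≠ 0 := by
    rw [ENNReal.ofReal_ne_zero_iff]; positivity
  exact (ENNReal.mul_right_inj hne ENNReal.ofReal_ne_top).1 h2

/-- Every unit vector is the image of the first basis vector by a unitary map. -/
theorem exists_unitary_map_cons {N : ℕ} (a : Fin (N + 1) → ℂ) (ha : ∑ i, ‖a i‖ ^ 2 = 1) :
    ∃ U : (Fin (N + 1) → ℂ) →ₗ[ℂ] (Fin (N + 1) → ℂ),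
      (∀ z, ∑ i, ‖U z i‖ ^ 2 = ∑ i, ‖z i‖ ^ 2) ∧ U (Fin.cons 1 0) = a := by
  have hnorm : ‖WithLp.toLp 2 a‖ = 1 := by
    rw [EuclideanSpace.norm_eq, Real.sqrt_eq_one]
    exact ha
  obtain ⟨b, hb⟩ := Orthonormal.exists_orthonormalBasis_extension_of_card_eq (𝕜 := ℂ)
    (E := EuclideanSpace ℂ (Fin (N + 1))) (ι := Fin (N + 1)) (by simp)
    (v := fun _ => WithLp.toLp 2 a) (s := {0})
    ⟨fun i => hnorm, fun i j hij => absurd (Subsingleton.elim i j) hij⟩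
  refine ⟨(WithLp.linearEquiv 2 ℂ (Fin (N + 1) → ℂ)).toLinearMap ∘ₗ
    (b.repr.symm.toLinearEquiv : EuclideanSpace ℂ (Fin (N + 1)) →ₗ[ℂ] _) ∘ₗ
      (WithLp.linearEquiv 2 ℂ (Fin (N + 1) → ℂ)).symm.toLinearMap, fun z => ?_, ?_⟩
  · have h : ‖b.repr.symm (WithLp.toLp 2 z)‖ ^ 2 = ‖WithLp.toLp 2 z‖ ^ 2 := by
      rw [b.repr.symm.norm_map]
    rwa [EuclideanSpace.norm_sq_eq, EuclideanSpace.norm_sq_eq] at h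
  · have h0 : (WithLp.toLp 2 (Fin.cons 1 0 : Fin (N + 1) → ℂ)) = EuclideanSpace.single 0 1 := by
      ext i
      refine Fin.cases ?_ (fun j => ?_) i <;> simp
    have h1 : b 0 = WithLp.toLp 2 a := hb 0 rfl
    change (b.repr.symm (WithLp.toLp 2 (Fin.cons 1 0 : Fin (N + 1) → ℂ))).ofLp = a
    rw [h0, b.repr_symm_single, h1]

/-! ### The mean value inequality on circles -/

theorem lintegral_circleMap_smul_density {N : ℕ} {f : (Fin N → ℂ) → ENNReal} (hf : Measurable f)
    (θ : ℝ) : ∫⁻ w, f (circleMap 0 1 θ • w) * ENNReal.ofReal (density w) =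
      ∫⁻ w, f w * ENNReal.ofReal (density w) := by
  have h1 : ‖circleMap 0 1 θ‖ = 1 := by simp
  have hc : circleMap 0 1 θ ≠ 0 := norm_ne_zero_iff.1 (by rw [h1]; exact one_ne_zero)
  rw [lintegral_eq_mul_lintegral_comp_smul hc (f := fun w => f w * ENNReal.ofReal (density w))
    (hf.mul measurable_density.ennreal_ofReal), h1, one_pow, ENNReal.ofReal_one, one_mul]
  simp only [density_eq, Pi.smul_apply, smul_eq_mul, norm_mul, h1, one_mul]

/-- If the means of `f` over the circles centred at `0` are at most `g`, then the mean of `f` for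
`ω_FS^N` is at most that of `g`. -/
theorem lintegral_density_le_of_circle {N : ℕ} {f g : (Fin N → ℂ) → ENNReal} (hf : Measurable f)
    (hfg : ∀ w, ∫⁻ θ in Set.Ioc 0 (2 * Real.pi), f (circleMap 0 1 θ • w) ≤
      ENNReal.ofReal (2 * Real.pi) * g w) :
    ∫⁻ w, f w * ENNReal.ofReal (density w) ≤ ∫⁻ w, g w * ENNReal.ofReal (density w) := by
  have hm : Measurable fun p : ℝ × (Fin N → ℂ) =>
      f (circleMap 0 1 p.1 • p.2) * ENNReal.ofReal (density p.2) := by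
    refine (hf.comp ?_).mul (measurable_density.comp measurable_snd).ennreal_ofReal
    exact (((continuous_circleMap 0 1).comp continuous_fst).smul continuous_snd).measurable
  have hpi : ENNReal.ofReal (2 * Real.pi) ≠ 0 := by
    rw [ENNReal.ofReal_ne_zero_iff]; positivity
  rw [← ENNReal.mul_le_mul_iff_right hpi ENNReal.ofReal_ne_top]
  calc ENNReal.ofReal (2 * Real.pi) * ∫⁻ w, f w * ENNReal.ofReal (density w)
      = ∫⁻ θ in Set.Ioc 0 (2 * Real.pi), ∫⁻ w,
          f (circleMap 0 1 θ • w) * ENNReal.ofReal (density w) := by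
        simp only [lintegral_circleMap_smul_density hf]
        rw [lintegral_const, Measure.restrict_apply_univ, Real.volume_Ioc, sub_zero, mul_comm]
    _ = ∫⁻ w, ∫⁻ θ in Set.Ioc 0 (2 * Real.pi),
          f (circleMap 0 1 θ • w) * ENNReal.ofReal (density w) :=
        lintegral_lintegral_swap hm.aemeasurable
    _ ≤ ∫⁻ w, ENNReal.ofReal (2 * Real.pi) * (g w * ENNReal.ofReal (density w)) := by
        refine lintegral_mono fun w => ?_
        rw [lintegral_mul_const' _ _ ENNReal.ofReal_ne_top, ← mul_assoc]
        gcongr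
        exact hfg w
    _ = ENNReal.ofReal (2 * Real.pi) * ∫⁻ w, g w * ENNReal.ofReal (density w) :=
        lintegral_const_mul' _ _ ENNReal.ofReal_ne_top

theorem ae_eval_circleMap_ne_zero {q : Polynomial ℂ} (hq : q ≠ 0) :
    ∀ᵐ θ : ℝ, q.eval (circleMap 0 1 θ) ≠ 0 := by
  have h : (circleMap 0 1 ⁻¹' {x | q.eval x = 0}).Countable :=
    ((Polynomial.finite_setOfPred_isRoot hq).countable).preimage_circleMap 0 one_ne_zero
  filter_upwards [compl_mem_ae_iff.2 (h.measure_zero volume)] with θ hθ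
  exact hθ

/-- The sub-mean value property of `log|q|`, read off from the bound of coefficients by the Mahler
measure: for the constant coefficient the binomial factor is `1`. -/
theorem log_norm_eval_zero_le_logMahlerMeasure {q : Polynomial ℂ} (hq : q.eval 0 ≠ 0) :
    Real.log ‖q.eval 0‖ ≤ q.logMahlerMeasure := by
  rw [Polynomial.logMahlerMeasure_eq_log_MahlerMeasure]
  refine Real.log_le_log (norm_pos_iff.2 hq) ?_
  simpa [Polynomial.coeff_zero_eq_eval_zero] using q.norm_coeff_le_choose_mul_mahlerMeasure 0

theorem lintegral_circle_sub_log_norm_le {q : Polynomial ℂ} (hq : q.eval 0 ≠ 0) {B : ℝ}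
    (hB : ∀ θ, Real.log ‖q.eval (circleMap 0 1 θ)‖ ≤ B) :
    ∫⁻ θ in Set.Ioc 0 (2 * Real.pi),
        ENNReal.ofReal (B - Real.log ‖q.eval (circleMap 0 1 θ)‖) ≤
      ENNReal.ofReal (2 * Real.pi) * ENNReal.ofReal (B - Real.log ‖q.eval 0‖) := by
  have hpi : (0 : ℝ) ≤ 2 * Real.pi := by positivity
  have hint := q.intervalIntegrable_mahlerMeasure
  have hint' := (intervalIntegrable_iff_integrableOn_Ioc_of_le hpi).1 hint
  have hc : IntegrableOn (fun _ : ℝ => B) (Set.Ioc 0 (2 * Real.pi)) :=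
    integrableOn_const measure_Ioc_lt_top.ne
  rw [← ofReal_integral_eq_lintegral_ofReal
    (f := fun θ => B - Real.log ‖q.eval (circleMap 0 1 θ)‖) (hc.sub hint')
    (Filter.Eventually.of_forall fun θ => sub_nonneg.2 (hB θ)), ← ENNReal.ofReal_mul hpi]
  refine ENNReal.ofReal_le_ofReal ?_
  have h := log_norm_eval_zero_le_logMahlerMeasure hq
  rw [Polynomial.logMahlerMeasure_def, Real.circleAverage_def, smul_eq_mul,
    intervalIntegral.integral_of_le hpi, le_inv_mul_iff₀ (by positivity)] at h
  rw [integral_sub hc hint', integral_const]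
  simp only [measureReal_restrict_apply_univ, Real.volume_real_Ioc_of_le hpi, sub_zero, smul_eq_mul]
  rw [mul_sub]
  linarith

/-! ### The pointwise norm on vectors -/

/-- The restriction of a polynomial to the line `t ↦ a + t b`. -/
noncomputable def linePoly {n : ℕ} (P : MvPolynomial (Fin n) ℂ) (a b : Fin n → ℂ) :
    Polynomial ℂ :=
  MvPolynomial.aeval (fun i => Polynomial.C (a i) + Polynomial.X * Polynomial.C (b i)) P

theorem eval_linePoly {n : ℕ} (P : MvPolynomial (Fin n) ℂ) (a b : Fin n → ℂ) (t : ℂ) :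
    (linePoly P a b).eval t = MvPolynomial.eval (a + t • b) P := by
  have h : (Polynomial.evalRingHom t).comp (MvPolynomial.aeval (R := ℂ) fun i =>
      Polynomial.C (a i) + Polynomial.X * Polynomial.C (b i)).toRingHom =
      MvPolynomial.eval (a + t • b) := by
    apply MvPolynomial.ringHom_ext
    · intro r
      simp
    · intro i
      simp
      ring
  exact DFunLike.congr_fun h P

/-- The pointwise norm of `P`, as a function of the homogeneous coordinates. -/
noncomputable def vecNorm {n : ℕ} (d : ℕ) (P : MvPolynomial (Fin n) ℂ) (z : Fin n → ℂ) : ℝ :=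
  Real.sqrt (‖MvPolynomial.eval z P‖ ^ 2 / (∑ i, ‖z i‖ ^ 2) ^ d)

theorem measurable_vecNorm {n : ℕ} (d : ℕ) (P : MvPolynomial (Fin n) ℂ) :
    Measurable (vecNorm d P) := by
  have := (MvPolynomial.continuous_eval P).measurable
  unfold vecNorm
  fun_prop

theorem vecNorm_nonneg {n : ℕ} (d : ℕ) (P : MvPolynomial (Fin n) ℂ) (z : Fin n → ℂ) :
    0 ≤ vecNorm d P z := Real.sqrt_nonneg _

theorem vecNorm_smul {N d : ℕ} {P : MvPolynomial (Fin (N + 1)) ℂ} (hP : P.IsHomogeneous d)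
    {c : ℂ} (hc : c ≠ 0) (z : Fin (N + 1) → ℂ) : vecNorm d P (c • z) = vecNorm d P z := by
  rcases eq_or_ne z 0 with rfl | hz
  · rw [smul_zero]
  · unfold vecNorm
    rw [← pointNorm_mk hP z hz, ← pointNorm_mk hP _ (smul_ne_zero hc hz)]
    congr 1
    rw [Projectivization.mk_eq_mk_iff']
    exact ⟨c, rfl⟩

/-- Each `‖z i‖` is at most the Euclidean norm. The crude constant serves only for boundedness and
drops out of the final estimate. -/
theorem norm_eval_le {n d : ℕ} {P : MvPolynomial (Fin n) ℂ} (hP : P.IsHomogeneous d)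
    (z : Fin n → ℂ) : ‖MvPolynomial.eval z P‖ ≤
      (∑ s ∈ P.support, ‖P.coeff s‖) * Real.sqrt (∑ i, ‖z i‖ ^ 2) ^ d := by
  rw [MvPolynomial.eval_eq', Finset.sum_mul]
  refine (norm_sum_le _ _).trans (Finset.sum_le_sum fun s hs => ?_)
  have hd : ∑ i, s i = d := by
    rw [hP.degree_eq_sum_deg_support hs, ← Finsupp.degree_apply, Finsupp.degree_eq_sum]
  rw [norm_mul, norm_prod, ← hd, ← Finset.prod_pow_eq_pow_sum]
  refine mul_le_mul_of_nonneg_left (Finset.prod_le_prod (fun i _ => norm_nonneg _)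
    fun i _ => ?_) (norm_nonneg _)
  rw [norm_pow]
  refine pow_le_pow_left₀ (norm_nonneg _) (Real.le_sqrt_of_sq_le ?_) _
  exact Finset.single_le_sum (f := fun i => ‖z i‖ ^ 2) (fun i _ => by positivity)
    (Finset.mem_univ i)

theorem vecNorm_le {n d : ℕ} {P : MvPolynomial (Fin n) ℂ} (hP : P.IsHomogeneous d)
    (z : Fin n → ℂ) : vecNorm d P z ≤ ∑ s ∈ P.support, ‖P.coeff s‖ := by
  have hS : 0 ≤ ∑ i, ‖z i‖ ^ 2 := by positivity
  have hC : 0 ≤ ∑ s ∈ P.support, ‖P.coeff s‖ := by positivity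
  refine Real.sqrt_le_iff.2 ⟨hC, ?_⟩
  refine div_le_of_le_mul₀ (by positivity) (by positivity) ?_
  calc ‖MvPolynomial.eval z P‖ ^ 2
      ≤ ((∑ s ∈ P.support, ‖P.coeff s‖) * Real.sqrt (∑ i, ‖z i‖ ^ 2) ^ d) ^ 2 :=
        pow_le_pow_left₀ (norm_nonneg _) (norm_eval_le hP z) 2
    _ = (∑ s ∈ P.support, ‖P.coeff s‖) ^ 2 * (∑ i, ‖z i‖ ^ 2) ^ d := by
        rw [mul_pow, ← pow_mul, mul_comm d 2, pow_mul, Real.sq_sqrt hS]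

theorem log_vecNorm {n d : ℕ} {P : MvPolynomial (Fin n) ℂ} {z : Fin n → ℂ}
    (hz : 0 < ∑ i, ‖z i‖ ^ 2) (h : MvPolynomial.eval z P ≠ 0) :
    Real.log (vecNorm d P z) =
      Real.log ‖MvPolynomial.eval z P‖ - d / 2 * Real.log (∑ i, ‖z i‖ ^ 2) := by
  have h0 : ‖MvPolynomial.eval z P‖ ≠ 0 := norm_ne_zero_iff.2 h
  rw [vecNorm, Real.log_sqrt (by positivity), Real.log_div (pow_ne_zero _ h0)
    (pow_ne_zero _ hz.ne'), Real.log_pow, Real.log_pow]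
  push_cast
  ring

/-- The mean of a function of `|P|` for `ω_FS^N` may be computed in a unitary frame centred at any
unit vector `a`, by circle averages over the lines through `a`. -/
theorem lintegral_comp_vecNorm_le {N d : ℕ} {P : MvPolynomial (Fin (N + 1)) ℂ}
    (hP : P.IsHomogeneous d) {a : Fin (N + 1) → ℂ} (ha : ∑ i, ‖a i‖ ^ 2 = 1) {φ : ℝ → ENNReal}
    (hφ : Measurable φ) {g : ℝ → ENNReal}
    (hg : ∀ (b : Fin (N + 1) → ℂ) (S : ℝ), 1 ≤ S →
      (∀ θ, ∑ i, ‖(a + circleMap 0 1 θ • b) i‖ ^ 2 = S) →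
      ∫⁻ θ in Set.Ioc 0 (2 * Real.pi), φ (vecNorm d P (a + circleMap 0 1 θ • b)) ≤
        ENNReal.ofReal (2 * Real.pi) * g S) :
    ∫⁻ w : Fin N → ℂ, φ (vecNorm d P (Fin.cons 1 w)) * ENNReal.ofReal (density w) ≤
      ∫⁻ w : Fin N → ℂ, g (1 + ∑ j, ‖w j‖ ^ 2) * ENNReal.ofReal (density w) := by
  obtain ⟨U, hU, hUa⟩ := exists_unitary_map_cons a ha
  have hφv : Measurable fun z => φ (vecNorm d P z) := hφ.comp (measurable_vecNorm d P)
  rw [← lintegral_density_comp_unitary hU (F := fun z => φ (vecNorm d P z)) hφv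
    fun c z hc => by rw [vecNorm_smul hP hc]]
  have hcons : Measurable fun w : Fin N → ℂ => (Fin.cons 1 w : Fin (N + 1) → ℂ) :=
    measurable_finCons.comp measurable_prodMk_left
  have hUm : Measurable U := U.continuous_of_finiteDimensional.measurable
  refine lintegral_density_le_of_circle (hφv.comp (hUm.comp hcons)) fun w => ?_
  -- The rotated chart maps complex lines through `0` to lines through `a`; since `U` preserves
  -- norms, the squared norm on the unit circle of such a line is `1 + |w|²`, independent of `θ`.
  have hline : ∀ t : ℂ, U (Fin.cons 1 (t • w)) = a + t • U (Fin.cons 0 w) := by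
    intro t
    rw [← hUa, ← map_smul, ← map_add]
    congr 1
    ext i
    refine Fin.cases ?_ (fun j => ?_) i <;> simp
  simp only [hline]
  refine hg _ _ ?_ fun θ => ?_
  · have : 0 ≤ ∑ j, ‖w j‖ ^ 2 := by positivity
    linarith
  · rw [← hline, hU, Fin.sum_univ_succ]
    simp

/-- The core estimate: Jensen on each circle around `a`, then the mean of `log (1 + |w|²)`.
Subtracting from `B` makes the integrand nonnegative and reverses the inequality. -/
theorem lintegral_sub_log_vecNorm_le {N d : ℕ} {P : MvPolynomial (Fin (N + 1)) ℂ}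
    (hP : P.IsHomogeneous d) {a : Fin (N + 1) → ℂ} (ha : ∑ i, ‖a i‖ ^ 2 = 1)
    (hPa : MvPolynomial.eval a P ≠ 0) {B : ℝ} (hB0 : 0 ≤ B)
    (hB : ∀ z, Real.log (vecNorm d P z) ≤ B) :
    ∫⁻ w : Fin N → ℂ, ENNReal.ofReal (B - Real.log (vecNorm d P (Fin.cons 1 w))) *
        ENNReal.ofReal (density w) ≤
      ENNReal.ofReal ((d : ℝ) / 2 * ∑ j ∈ Finset.Icc 1 N, 1 / (j : ℝ) +
        (B - Real.log ‖MvPolynomial.eval a P‖)) := by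
  have hBa : 0 ≤ B - Real.log ‖MvPolynomial.eval a P‖ := by
    have h := hB a
    rw [log_vecNorm (by rw [ha]; exact one_pos) hPa, ha, Real.log_one] at h
    linarith
  rw [← lintegral_density_mul_log N (by positivity) hBa]
  refine (lintegral_comp_vecNorm_le hP ha (φ := fun x => ENNReal.ofReal (B - Real.log x))
    (by fun_prop) (g := fun S => ENNReal.ofReal ((d : ℝ) / 2 * Real.log S +
      (B - Real.log ‖MvPolynomial.eval a P‖))) ?_).trans_eq (by simp only [mul_comm])
  intro b S hS hbS
  have hlogS : 0 ≤ (d : ℝ) / 2 * Real.log S := mul_nonneg (by positivity) (Real.log_nonneg hS)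
  have hq0 : (linePoly P a b).eval 0 = MvPolynomial.eval a P := by
    rw [eval_linePoly, zero_smul, add_zero]
  have hq0' : (linePoly P a b).eval 0 ≠ 0 := by rwa [hq0]
  have hq : linePoly P a b ≠ 0 := fun h => hq0' (by rw [h, Polynomial.eval_zero])
  have hval : ∀ θ, (linePoly P a b).eval (circleMap 0 1 θ) ≠ 0 →
      Real.log (vecNorm d P (a + circleMap 0 1 θ • b)) =
        Real.log ‖(linePoly P a b).eval (circleMap 0 1 θ)‖ - d / 2 * Real.log S := by
    intro θ hθ
    rw [eval_linePoly] at hθ ⊢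
    rw [log_vecNorm (by rw [hbS]; linarith) hθ, hbS]
  -- At a zero of the polynomial `Real.log 0 = 0`, so the bound there needs `0 ≤ B` and `1 ≤ S`.
  have h := lintegral_circle_sub_log_norm_le hq0' (B := (d : ℝ) / 2 * Real.log S + B) fun θ => by
    rcases eq_or_ne ((linePoly P a b).eval (circleMap 0 1 θ)) 0 with h0 | h0
    · rw [h0, norm_zero, Real.log_zero]
      positivity
    · have h1 := hB (a + circleMap 0 1 θ • b)
      rw [hval θ h0] at h1
      linarith
  rw [hq0, add_sub_assoc] at h
  refine le_trans (le_of_eq (lintegral_congr_ae (ae_restrict_of_ae ?_))) h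
  filter_upwards [ae_eval_circleMap_ne_zero hq] with θ hθ
  rw [hval θ hθ]
  congr 1
  ring

/-- The zero set of `P` is null: on a line through `a` the polynomial is nonzero at `a`, so it
vanishes on the circle only for countably many `θ`. -/
theorem lintegral_vecNorm_eq_zero {N d : ℕ} {P : MvPolynomial (Fin (N + 1)) ℂ}
    (hP : P.IsHomogeneous d) {a : Fin (N + 1) → ℂ} (ha : ∑ i, ‖a i‖ ^ 2 = 1)
    (hPa : MvPolynomial.eval a P ≠ 0) :
    ∫⁻ w : Fin N → ℂ, Set.indicator {0} 1 (vecNorm d P (Fin.cons 1 w)) *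
      ENNReal.ofReal (density w) = 0 := by
  refine le_antisymm ((lintegral_comp_vecNorm_le hP ha (φ := Set.indicator {0} 1)
    (measurable_one.indicator (measurableSet_singleton 0)) (g := fun _ => 0) ?_).trans_eq
      (by simp)) zero_le
  intro b S hS hbS
  have hq : linePoly P a b ≠ 0 := by
    intro h
    have h0 := eval_linePoly P a b 0
    rw [h, zero_smul, add_zero, Polynomial.eval_zero] at h0
    exact hPa h0.symm
  rw [mul_zero, le_zero_iff]
  refine (lintegral_congr_ae (ae_restrict_of_ae ?_)).trans lintegral_zero
  filter_upwards [ae_eval_circleMap_ne_zero hq] with θ hθ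
  rw [eval_linePoly] at hθ
  refine Set.indicator_of_notMem ?_ _
  have h1 : 0 < ‖MvPolynomial.eval (a + circleMap 0 1 θ • b) P‖ := norm_pos_iff.2 hθ
  refine (Real.sqrt_pos.2 ?_).ne'
  rw [hbS]
  positivity

/-! ### Comparison of the norms -/

theorem pointNorm_mk_eq_vecNorm {N d : ℕ} {P : MvPolynomial (Fin (N + 1)) ℂ}
    (hP : P.IsHomogeneous d) {z : Fin (N + 1) → ℂ} (hz : z ≠ 0) :
    pointNorm d P (Projectivization.mk ℂ z hz) = vecNorm d P z :=
  pointNorm_mk hP z hz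

theorem sum_norm_sq_pos {n : ℕ} {z : Fin n → ℂ} (hz : z ≠ 0) : 0 < ∑ i, ‖z i‖ ^ 2 := by
  obtain ⟨i, hi⟩ := Function.ne_iff.1 hz
  exact Finset.sum_pos' (fun i _ => by positivity)
    ⟨i, Finset.mem_univ i, pow_pos (norm_pos_iff.2 hi) 2⟩

theorem continuous_pointNorm {N d : ℕ} {P : MvPolynomial (Fin (N + 1)) ℂ}
    (hP : P.IsHomogeneous d) : Continuous (pointNorm d P) := by
  refine continuous_coinduced_dom.2 ?_
  have h : pointNorm d P ∘ (Projectivization.mk' ℂ : {v : Fin (N + 1) → ℂ // v ≠ 0} → PN N) =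
      fun v => vecNorm d P v.1 := funext fun v => pointNorm_mk hP v.1 v.2
  rw [h]
  have hc := (MvPolynomial.continuous_eval P).comp
    (continuous_subtype_val : Continuous (Subtype.val : {v : Fin (N + 1) → ℂ // v ≠ 0} → _))
  simp only [Function.comp_def] at hc
  refine Real.continuous_sqrt.comp ((hc.norm.pow 2).div ?_ fun v =>
    pow_ne_zero _ (sum_norm_sq_pos v.2).ne')
  exact (continuous_finsetSum _ fun i _ =>
    ((continuous_apply i).comp continuous_subtype_val).norm.pow 2).pow d

theorem pointNorm_nonneg {N d : ℕ} (P : MvPolynomial (Fin (N + 1)) ℂ) (x : PN N) :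
    0 ≤ pointNorm d P x := Real.sqrt_nonneg _

theorem lintegral_comp_pointNorm {N d : ℕ} {P : MvPolynomial (Fin (N + 1)) ℂ}
    (hP : P.IsHomogeneous d) {φ : ℝ → ENNReal} (hφ : Measurable φ) :
    ∫⁻ x, φ (pointNorm d P x) ∂(measure N) =
      ∫⁻ w : Fin N → ℂ, φ (vecNorm d P (Fin.cons 1 w)) * ENNReal.ofReal (density w) := by
  have hm : Measurable fun x => φ (pointNorm d P x) :=
    hφ.comp (continuous_pointNorm hP).measurable
  rw [measure, lintegral_map hm measurable_chart,
    lintegral_withDensity_eq_lintegral_mul _ measurable_density.ennreal_ofReal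
      (g := fun w => φ (pointNorm d P (chart w))) (hm.comp measurable_chart)]
  refine lintegral_congr fun w => ?_
  rw [Pi.mul_apply, mul_comm, chart, pointNorm_mk_eq_vecNorm hP]

instance (N : ℕ) : IsProbabilityMeasure (measure N) := by
  constructor
  rw [measure, Measure.map_apply measurable_chart MeasurableSet.univ, Set.preimage_univ,
    withDensity_apply _ MeasurableSet.univ, Measure.restrict_univ, lintegral_density]

theorem exists_unit_vector {N d : ℕ} {P : MvPolynomial (Fin (N + 1)) ℂ}
    (hP : P.IsHomogeneous d) (x : PN N) : ∃ a : Fin (N + 1) → ℂ,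
      ∑ i, ‖a i‖ ^ 2 = 1 ∧ pointNorm d P x = ‖MvPolynomial.eval a P‖ := by
  have hS := sum_norm_sq_pos x.rep_nonzero
  set S := ∑ i, ‖x.rep i‖ ^ 2 with hSdef
  have hc : (((Real.sqrt S)⁻¹ : ℝ) : ℂ) ≠ 0 := by
    rw [Complex.ofReal_ne_zero]; positivity
  have ha : ∑ i, ‖((((Real.sqrt S)⁻¹ : ℝ) : ℂ) • x.rep) i‖ ^ 2 = 1 := by
    simp only [Pi.smul_apply, smul_eq_mul, norm_mul, mul_pow, ← Finset.mul_sum, ← hSdef,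
      Complex.norm_real, Real.norm_eq_abs, sq_abs, inv_pow, Real.sq_sqrt hS.le]
    exact inv_mul_cancel₀ hS.ne'
  refine ⟨_, ha, ?_⟩
  change vecNorm d P x.rep = _
  rw [← vecNorm_smul hP hc, vecNorm, ha, one_pow, div_one, Real.sqrt_sq (norm_nonneg _)]

theorem exists_pointNorm_pos {N d : ℕ} {P : MvPolynomial (Fin (N + 1)) ℂ}
    (hP : P.IsHomogeneous d) (hP0 : P ≠ 0) : ∃ x, 0 < pointNorm d P x := by
  -- The factor `X 0` forces the point of nonvanishing to be a nonzero vector, which matters when `d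
  -- = 0`.
  have h : P * MvPolynomial.X 0 ≠ 0 := mul_ne_zero hP0 (MvPolynomial.X_ne_zero 0)
  obtain ⟨z, hz⟩ : ∃ z, MvPolynomial.eval z (P * MvPolynomial.X 0) ≠ 0 := by
    by_contra! hcon
    exact h (MvPolynomial.funext fun z => by rw [hcon z, map_zero])
  rw [map_mul, MvPolynomial.eval_X] at hz
  have hz0 : z ≠ 0 := fun h0 => right_ne_zero_of_mul hz (by rw [h0, Pi.zero_apply])
  have h1 : 0 < ‖MvPolynomial.eval z P‖ := norm_pos_iff.2 (left_ne_zero_of_mul hz)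
  refine ⟨Projectivization.mk ℂ z hz0, ?_⟩
  rw [pointNorm_mk hP]
  have := sum_norm_sq_pos hz0
  positivity

theorem pointNorm_le {N d : ℕ} {P : MvPolynomial (Fin (N + 1)) ℂ} (hP : P.IsHomogeneous d)
    (x : PN N) : pointNorm d P x ≤ ∑ s ∈ P.support, ‖P.coeff s‖ :=
  vecNorm_le hP x.rep

theorem bddAbove_range_pointNorm {N d : ℕ} {P : MvPolynomial (Fin (N + 1)) ℂ}
    (hP : P.IsHomogeneous d) : BddAbove (Set.range (pointNorm d P)) :=
  ⟨_, Set.forall_mem_range.2 (pointNorm_le hP)⟩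

theorem ae_pointNorm_pos {N d : ℕ} {P : MvPolynomial (Fin (N + 1)) ℂ}
    (hP : P.IsHomogeneous d) (hP0 : P ≠ 0) : ∀ᵐ x ∂(measure N), 0 < pointNorm d P x := by
  obtain ⟨x, hx⟩ := exists_pointNorm_pos hP hP0
  obtain ⟨a, ha, hxa⟩ := exists_unit_vector hP x
  have hφ : Measurable (Set.indicator {0} 1 : ℝ → ENNReal) :=
    measurable_one.indicator (measurableSet_singleton 0)
  have h := lintegral_comp_pointNorm hP hφ
  rw [lintegral_vecNorm_eq_zero hP ha (norm_pos_iff.1 (hxa ▸ hx)),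
    lintegral_eq_zero_iff (f := fun x => Set.indicator {0} 1 (pointNorm d P x))
      (hφ.comp (continuous_pointNorm hP).measurable)] at h
  filter_upwards [h] with y hy
  refine (pointNorm_nonneg P y).lt_of_ne' fun h0 => ?_
  simp [h0] at hy

theorem log_vecNorm_le {N d : ℕ} {P : MvPolynomial (Fin (N + 1)) ℂ} (hP : P.IsHomogeneous d) :
    ∃ B : ℝ, 0 ≤ B ∧ ∀ z, Real.log (vecNorm d P z) ≤ B := by
  refine ⟨∑ s ∈ P.support, ‖P.coeff s‖, by positivity, fun z => ?_⟩
  exact (Real.log_le_self (vecNorm_nonneg d P z)).trans (vecNorm_le hP z)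

/-- One finite upper bound for the integral of `B - log|P|` gives both claims: finiteness gives
integrability, and then `B` cancels because the total mass is `1`. -/
theorem integrable_log_and_log_le {N d : ℕ} {P : MvPolynomial (Fin (N + 1)) ℂ}
    (hP : P.IsHomogeneous d) {x : PN N} (hx : 0 < pointNorm d P x) :
    Integrable (fun x => Real.log (pointNorm d P x)) (measure N) ∧
      Real.log (pointNorm d P x) ≤ ∫ x, Real.log (pointNorm d P x) ∂(measure N) +
        (d : ℝ) / 2 * ∑ j ∈ Finset.Icc 1 N, 1 / (j : ℝ) := by
  obtain ⟨B, hB0, hB⟩ := log_vecNorm_le hP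
  obtain ⟨a, ha, hxa⟩ := exists_unit_vector hP x
  have hle := lintegral_sub_log_vecNorm_le hP ha (norm_pos_iff.1 (hxa ▸ hx)) hB0 hB
  rw [← lintegral_comp_pointNorm hP (φ := fun t => ENNReal.ofReal (B - Real.log t))
    (by fun_prop), ← hxa] at hle
  have hnn : 0 ≤ᵐ[measure N] fun x => B - Real.log (pointNorm d P x) :=
    Filter.Eventually.of_forall fun y => sub_nonneg.2 (hB y.rep)
  have hm : Measurable fun x => B - Real.log (pointNorm d P x) :=
    ((continuous_pointNorm hP).measurable.log).const_sub B
  have hint : Integrable (fun x => B - Real.log (pointNorm d P x)) (measure N) :=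
    (lintegral_ofReal_ne_top_iff_integrable hm.aestronglyMeasurable hnn).1
      (hle.trans_lt ENNReal.ofReal_lt_top).ne
  have hlog : Integrable (fun x => Real.log (pointNorm d P x)) (measure N) := by
    refine ((integrable_const B).sub hint).congr (Filter.Eventually.of_forall fun y => ?_)
    simp
  refine ⟨hlog, ?_⟩
  have hBx : 0 ≤ B - Real.log (pointNorm d P x) := sub_nonneg.2 (hB x.rep)
  rw [← ofReal_integral_eq_lintegral_ofReal hint hnn, ENNReal.ofReal_le_ofReal_iff
    (by positivity), integral_sub (integrable_const B) hlog,
    integral_const, probReal_univ, one_smul] at hle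
  linarith

theorem pointNorm_le_supNorm {N d : ℕ} {P : MvPolynomial (Fin (N + 1)) ℂ}
    (hP : P.IsHomogeneous d) (x : PN N) : pointNorm d P x ≤ supNorm d P :=
  le_ciSup (bddAbove_range_pointNorm hP) x

theorem supNorm_pos {N d : ℕ} {P : MvPolynomial (Fin (N + 1)) ℂ}
    (hP : P.IsHomogeneous d) (hP0 : P ≠ 0) : 0 < supNorm d P := by
  obtain ⟨x, hx⟩ := exists_pointNorm_pos hP hP0
  exact hx.trans_le (pointNorm_le_supNorm hP x)

theorem log_supNorm_le {N d : ℕ} {P : MvPolynomial (Fin (N + 1)) ℂ}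
    (hP : P.IsHomogeneous d) (hP0 : P ≠ 0) : Real.log (supNorm d P) ≤
      Real.log (mahlerNorm d P) + (d : ℝ) / 2 * ∑ j ∈ Finset.Icc 1 N, 1 / (j : ℝ) := by
  obtain ⟨x₀, -⟩ := exists_pointNorm_pos hP hP0
  have : Nonempty (PN N) := ⟨x₀⟩
  rw [mahlerNorm, Real.log_exp, Real.log_le_iff_le_exp (supNorm_pos hP hP0)]
  refine ciSup_le fun x => ?_
  rcases (pointNorm_nonneg P x).eq_or_lt with h | h
  · rw [← h]
    exact (Real.exp_pos _).le
  · rw [← Real.log_le_iff_le_exp h]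
    exact (integrable_log_and_log_le hP h).2

theorem integrable_log_pointNorm {N d : ℕ} {P : MvPolynomial (Fin (N + 1)) ℂ}
    (hP : P.IsHomogeneous d) (hP0 : P ≠ 0) :
    Integrable (fun x => Real.log (pointNorm d P x)) (measure N) := by
  obtain ⟨x, hx⟩ := exists_pointNorm_pos hP hP0
  exact (integrable_log_and_log_le hP hx).1

/-! ### The `L^p` norms between the Mahler measure and the sup norm -/

theorem integrable_pointNorm_rpow {N d : ℕ} {P : MvPolynomial (Fin (N + 1)) ℂ}
    (hP : P.IsHomogeneous d) {p : ℝ} (hp : 0 < p) :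
    Integrable (fun x => pointNorm d P x ^ p) (measure N) := by
  refine Integrable.of_bound
    ((continuous_pointNorm hP).measurable.pow_const p).aestronglyMeasurable (supNorm d P ^ p)
    (Filter.Eventually.of_forall fun x => ?_)
  rw [Real.norm_of_nonneg (Real.rpow_nonneg (pointNorm_nonneg P x) p)]
  exact Real.rpow_le_rpow (pointNorm_nonneg P x) (pointNorm_le_supNorm hP x) hp.le

/-- Jensen's inequality for `exp` applied to `p log|P|`. Almost everywhere positivity is needed
because at a zero of `P` the power is `0` while `exp (p * Real.log 0) = 1`. -/
theorem mahlerNorm_rpow_le {N d : ℕ} {P : MvPolynomial (Fin (N + 1)) ℂ}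
    (hP : P.IsHomogeneous d) (hP0 : P ≠ 0) {p : ℝ} (hp : 0 < p) :
    mahlerNorm d P ^ p ≤ ∫ x, pointNorm d P x ^ p ∂(measure N) := by
  have hae : (fun x => pointNorm d P x ^ p) =ᵐ[measure N]
      fun x => Real.exp (p * Real.log (pointNorm d P x)) := by
    filter_upwards [ae_pointNorm_pos hP hP0] with x hx
    rw [Real.rpow_def_of_pos hx, mul_comm]
  have h := convexOn_exp.map_integral_le (μ := measure N)
    (f := fun x => p * Real.log (pointNorm d P x)) Real.continuous_exp.continuousOn isClosed_univ
    (Filter.Eventually.of_forall fun _ => Set.mem_univ _)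
    ((integrable_log_pointNorm hP hP0).const_mul p)
    ((integrable_pointNorm_rpow hP hp).congr hae)
  rw [integral_congr_ae hae, mahlerNorm, ← Real.exp_mul, mul_comm, ← integral_const_mul]
  exact h

theorem mahlerNorm_le_lpNorm {N d : ℕ} {P : MvPolynomial (Fin (N + 1)) ℂ}
    (hP : P.IsHomogeneous d) (hP0 : P ≠ 0) {p : ℝ} (hp : 0 < p) :
    mahlerNorm d P ≤ lpNorm p d P := by
  have h0 : 0 ≤ mahlerNorm d P := (Real.exp_pos _).le
  have h := Real.rpow_le_rpow (Real.rpow_nonneg h0 p) (mahlerNorm_rpow_le hP hP0 hp)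
    (one_div_pos.2 hp).le
  rwa [← Real.rpow_mul h0, mul_one_div_cancel hp.ne', Real.rpow_one] at h

theorem lpNorm_le_supNorm {N d : ℕ} {P : MvPolynomial (Fin (N + 1)) ℂ}
    (hP : P.IsHomogeneous d) (hP0 : P ≠ 0) {p : ℝ} (hp : 0 < p) :
    lpNorm p d P ≤ supNorm d P := by
  have hS := (supNorm_pos hP hP0).le
  have h1 : ∫ x, pointNorm d P x ^ p ∂(measure N) ≤ supNorm d P ^ p := by
    have h := integral_mono (integrable_pointNorm_rpow hP hp)
      (integrable_const (μ := measure N) (supNorm d P ^ p)) fun x =>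
        Real.rpow_le_rpow (pointNorm_nonneg P x) (pointNorm_le_supNorm hP x) hp.le
    simpa using h
  have h := Real.rpow_le_rpow (integral_nonneg fun x => Real.rpow_nonneg (pointNorm_nonneg P x) p)
    h1 (one_div_pos.2 hp).le
  rwa [← Real.rpow_mul hS, mul_one_div_cancel hp.ne', Real.rpow_one] at h

end FubiniStudy

theorem mainTheorem8 (N d : ℕ) (P : MvPolynomial (Fin (N + 1)) ℂ)
    (hP : P.IsHomogeneous d) (hP0 : P ≠ 0) :
    -- the quantities in the inequalities are genuine
    (MeasureTheory.Integrable (fun x => Real.log (FubiniStudy.pointNorm d P x))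
        (FubiniStudy.measure N) ∧
      BddAbove (Set.range (FubiniStudy.pointNorm d P)) ∧
      0 < FubiniStudy.supNorm d P) ∧
    -- comparison of the Mahler measure and the sup norm
    (Real.log (FubiniStudy.mahlerNorm d P) ≤ Real.log (FubiniStudy.supNorm d P) ∧
      Real.log (FubiniStudy.supNorm d P) ≤
        Real.log (FubiniStudy.mahlerNorm d P)
          + (d : ℝ) / 2 * ∑ j ∈ Finset.Icc 1 N, 1 / (j : ℝ)) ∧
    -- comparison of the Mahler measure and the other norms
    (∀ p : ℝ, 0 < p →
      (MeasureTheory.Integrable (fun x => FubiniStudy.pointNorm d P x ^ p)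
          (FubiniStudy.measure N) ∧
        0 < FubiniStudy.lpNorm p d P) ∧
      Real.log (FubiniStudy.mahlerNorm d P) ≤ Real.log (FubiniStudy.lpNorm p d P) ∧
      Real.log (FubiniStudy.lpNorm p d P) ≤
        Real.log (FubiniStudy.mahlerNorm d P)
          + (d : ℝ) / 2 * ∑ j ∈ Finset.Icc 1 N, 1 / (j : ℝ)) := by
  have hM : 0 < FubiniStudy.mahlerNorm d P := Real.exp_pos _
  have hsup := FubiniStudy.log_supNorm_le hP hP0
  refine ⟨⟨FubiniStudy.integrable_log_pointNorm hP hP0, FubiniStudy.bddAbove_range_pointNorm hP,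
    FubiniStudy.supNorm_pos hP hP0⟩, ⟨?_, hsup⟩, fun p hp => ?_⟩
  -- Any exponent would serve as the intermediate norm; `p = 1` is taken.
  · exact Real.log_le_log hM ((FubiniStudy.mahlerNorm_le_lpNorm hP hP0 one_pos).trans
      (FubiniStudy.lpNorm_le_supNorm hP hP0 one_pos))
  · have hMp := FubiniStudy.mahlerNorm_le_lpNorm hP hP0 hp
    have hp0 := hM.trans_le hMp
    exact ⟨⟨FubiniStudy.integrable_pointNorm_rpow hP hp, hp0⟩, Real.log_le_log hM hMp,
      (Real.log_le_log hp0 (FubiniStudy.lpNorm_le_supNorm hP hP0 hp)).trans hsup⟩
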